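/- Conventions. $\mathbb{N}^{\mathbb{N}}$ is the monoid of all functions $\mathbb{N}\to\mathbb{N}$ under composition, with the pointwise topology $\mathcal{PT}_{\mathbb{N}}$, i.e. the product topology for discrete factors $\mathbb{N}$. $\mathcal{P}_{\mathbb{N}}$ is the monoid of all partial functions from $\mathbb{N}$ to $\mathbb{N}$ (functions from a subset of $\mathbb{N}$ to $\mathbb{N}$) under composition, with the partial pointwise topology $\mathcal{PPT}_{\mathbb{N}}$ generated by the sets $\{f : (x,y)\in f\}$ and $\{f : x\notin\operatorname{dom} f\}$ for $x,y\in\mathbb{N}$. A topology on a semigroup $S$ is *compatible* with $S$ if multiplication $S\times S\to S$ is continuous (so that $S$ is a topological semigroup), and *semicompatible* with $S$ if all left and right translations $t\mapsto st$ and $t\mapsto ts$ ($s\in S$) are continuous. *Fréchet* means that singletons are closed ($T_1$). No separation axiom is part of the definition of a topological semigroup. For a semigroup $S$ define: - the minimum Fréchet topology $\mathcal{MF}(S)$: the intersection of all Fréchet topologies semicompatible with $S$; - the Fréchet-Markov topology $\mathcal{FM}(S)$: the intersection of all Fréchet topologies compatible with $S$; - the Hausdorff-Markov topology $\mathcal{HM}(S)$: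 the intersection of all Hausdorff topologies compatible with $S$; - the Zariski topology $\mathcal{Z}(S)$: the topology generated by the complements of the sets $\{s\in S : a(s,s_1,\dots,s_{n-1})=b(s,t_1,\dots,t_{m-1})\}$, where $n,m\ge 1$, $s_i,t_j\in S$, and $a,b$ are semigroup terms (nonempty products of variables) in $n$ and $m$ variables respectively; - the second countable continuity topology $\mathcal{SCC}(S)$: the topology generated by the union of all second countable topologies compatible with $S$. Theorem. The topology $\mathcal{PT}_{\mathbb{N}}$ is second countable, Fréchet and compatible with the semigroup $\mathbb{N}^{\mathbb{N}}$, and it is the only such topology. Similarly, $\mathcal{PPT}_{\mathbb{N}}$ is second countable, Fréchet and compatible with the semigroup $\mathcal{P}_{\mathbb{N}}$, and it is the only such topology. Every semigroup homomorphism from $(\mathbb{N}^{\mathbb{N}},\mathcal{PT}_{\mathbb{N}})$ or from $(\mathcal{P}_{\mathbb{N}},\mathcal{PPT}_{\mathbb{N}})$ to a second countable topological semigroup is continuous. Moreover $$\mathcal{PT}_{\mathbb{N}}=\mathcal{Z}(\mathbb{N}^{\mathbb{N}})=\mathcal{MF}(\mathbb{N}^{\mathbb{N}})=\mathcal{FM}(\mathbb{N}^{\mathbb{N}})=\mathcal{HM}(\mathbb{N}^{\mathbb{N}})=\mathcal{SCC}(\mathbb{N}^{\mathbb{N}}),$$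 $$\mathcal{PPT}_{\mathbb{N}}=\mathcal{Z}(\mathcal{P}_{\mathbb{N}})=\mathcal{MF}(\mathcal{P}_{\mathbb{N}})=\mathcal{FM}(\mathcal{P}_{\mathbb{N}})=\mathcal{HM}(\mathcal{P}_{\mathbb{N}})=\mathcal{SCC}(\mathcal{P}_{\mathbb{N}}),$$ and both $\mathcal{PT}_{\mathbb{N}}$ and $\mathcal{PPT}_{\mathbb{N}}$ are Polish. -/

import Mathlib

open Topology

universe u

/-! ### Topologies on an arbitrary semigroup

In Mathlib's lattice `TopologicalSpace S` the order is reversed with respect to containment of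
the families of open sets, so that `sSup` is the intersection of a family of topologies:
`IsOpen[sSup C] U ↔ ∀ t ∈ C, IsOpen[t] U`. "Fréchet" means that points are closed (`T1Space`). -/

/-- The topology `t` is compatible with `S`: `(S, t)` is a topological semigroup, that is,
multiplication `S × S → S` is jointly continuous. -/
def IsCompatible (S : Type u) [Semigroup S] (t : TopologicalSpace S) : Prop :=
  @ContinuousMul S t _

/-- The topology `t` is semicompatible with `S`: `(S, t)` is a semitopological semigroup, that is,
all left and right translations are continuous. -/
def IsSemicompatible (S : Type u) [Semigroup S] (t : TopologicalSpace S) : Prop :=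
  @SeparatelyContinuousMul S t _

/-- The minimum Fréchet topology: the intersection of all Fréchet topologies semicompatible
with `S`. -/
def minimumFrechetTopology (S : Type u) [Semigroup S] : TopologicalSpace S :=
  sSup {t | @T1Space S t ∧ IsSemicompatible S t}

/-- The Fréchet-Markov topology: the intersection of all Fréchet topologies compatible
with `S`. -/
def frechetMarkovTopology (S : Type u) [Semigroup S] : TopologicalSpace S :=
  sSup {t | @T1Space S t ∧ IsCompatible S t}

/-- The Hausdorff-Markov topology: the intersection of all Hausdorff topologies compatible
with `S`. -/
def hausdorffMarkovTopology (S : Type u) [Semigroup S] : TopologicalSpace S :=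
  sSup {t | @T2Space S t ∧ IsCompatible S t}

/-- Elementary algebraic subsets of a semigroup: solution sets in `s` of an equation
`a(s, p₁, …, pₙ) = b(s, q₁, …, qₘ)`, where `a` and `b` are terms in the signature with one
binary symbol. Such terms over a variable set `V` are the elements of `FreeMagma V`, and
`FreeMagma.lift v a` is the value of the term `a` under the assignment `v`. -/
def IsElementaryAlgebraic {S : Type u} [Semigroup S] (E : Set S) : Prop :=
  ∃ (n m : ℕ) (p : Fin n → S) (q : Fin m → S)
    (a : FreeMagma (Fin (n + 1))) (b : FreeMagma (Fin (m + 1))),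
    E = {s : S | FreeMagma.lift (Fin.cons s p : Fin (n + 1) → S) a =
      FreeMagma.lift (Fin.cons s q : Fin (m + 1) → S) b}

/-- The Zariski topology: generated by the complements of the elementary algebraic sets. -/
def semigroupZariskiTopology (S : Type u) [Semigroup S] : TopologicalSpace S :=
  TopologicalSpace.generateFrom {U | ∃ E : Set S, IsElementaryAlgebraic E ∧ U = Eᶜ}

/-- The second countable continuity topology `SCC(S)`: generated by the union of all second
countable topologies compatible with `S`. -/
def secondCountableContinuityTopology (S : Type u) [Semigroup S] : TopologicalSpace S :=
  TopologicalSpace.generateFrom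
    {U | ∃ t : TopologicalSpace S,
      @SecondCountableTopology S t ∧ IsCompatible S t ∧ IsOpen[t] U}

/-! ### The full transformation monoid -/

/-- The set `X ^ X` of all functions from `X` to itself. -/
def FullTransformation (X : Type u) : Type u := X → X

/-- Composition of functions from left to right: `f * g` is `f` followed by `g`. -/
instance (X : Type u) : Monoid (FullTransformation X) where
  mul f g := fun x => g (f x)
  one := fun x => x
  mul_assoc _ _ _ := rfl
  one_mul _ := rfl
  mul_one _ := rfl

/-- The pointwise topology on `X ^ X`: the product topology for discrete factors `X`. -/
def pointwiseTopology (X : Type u) : TopologicalSpace (FullTransformation X) :=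
  @Pi.topologicalSpace X (fun _ => X) (fun _ => ⊥)

/-! ### The partial function monoid -/

/-- The set of all partial functions from `X` to itself, that is, of all functions from a subset
of `X` to `X`. -/
def PartialTransformation (X : Type u) : Type u := X →. X

/-- Composition of partial functions from left to right: `f * g` is `f` followed by `g`, so that
`z ∈ (f * g) x` if and only if there is `y ∈ f x` with `z ∈ g y`. -/
instance (X : Type u) : Monoid (PartialTransformation X) where
  mul f g := PFun.comp g f
  one := PFun.id X
  mul_assoc f g h := (PFun.comp_assoc h g f).symm
  one_mul f := PFun.comp_id f
  mul_one f := PFun.id_comp f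

/-- The partial pointwise topology: generated by the sets `{f | (x, y) ∈ f}` and
`{f | x ∉ dom f}` for `x, y ∈ X`. -/
def partialPointwiseTopology (X : Type u) : TopologicalSpace (PartialTransformation X) :=
  TopologicalSpace.generateFrom
    ({U | ∃ x y : X, U = {f : PartialTransformation X | y ∈ f x}} ∪
      {U | ∃ x : X, U = {f : PartialTransformation X | ¬ (f x).Dom}})

open Function Set Filter

/-! ### Second countable spaces and uncountable families -/

/-! Both monoids are sets of sequences `ℕ → A` with `A` countable and discrete; for partial
functions `A = Part ℕ`, undefinedness being one more letter. Two opposite bounds give everything.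
Each cylinder `{s | e s x = y}` is the complement of the solution set of some `p * s * q = r`, so it
is open in every semicompatible `T₁` topology and in the Zariski topology. Conversely, suppose a
neighbourhood `U` of `f` in a second countable compatible topology is not a pointwise neighbourhood.
Then some `g n` outside `U` agree with `f` below `n`. By `exists_branch_factorization`, `f` has
factorisations indexed by the branches of the binary tree whose mixed products are all among the `g
n`; but uncountably many factorisations force a mixed product into `U`
(`exists_ne_mul_mem_of_uncountable`). -/

/-- In a second countable space, an uncountable family of points with chosen neighbourhoods has
two members such that one lies in the neighbourhood of the other. -/
theorem exists_ne_mem_of_uncountable {ι X : Type*} [Uncountable ι] [TopologicalSpace X]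
    [SecondCountableTopology X] (p : ι → X) (U : ι → Set X) (hU : ∀ i, U i ∈ 𝓝 (p i)) :
    ∃ i j, i ≠ j ∧ p j ∈ U i := by
  have hB := TopologicalSpace.isBasis_countableBasis X
  have : ∀ i, ∃ B : TopologicalSpace.countableBasis X, p i ∈ B.1 ∧ B.1 ⊆ U i := fun i => by
    obtain ⟨B, hB1, hB2, hB3⟩ := hB.mem_nhds_iff.1 (hU i)
    exact ⟨⟨B, hB1⟩, hB2, hB3⟩
  choose B hpB hBU using this
  have hcount : Countable (TopologicalSpace.countableBasis X) :=
    (TopologicalSpace.countable_countableBasis X).to_subtype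
  have hB' : ¬ Injective B := fun h => not_countable (α := ι) h.countable
  obtain ⟨i, j, hij, hne⟩ : ∃ i j, B i = B j ∧ i ≠ j := by
    simpa [Injective] using hB'
  exact ⟨i, j, hne, hBU i (hij ▸ hpB j)⟩

/-- In a second countable topological semigroup, if `a i * b i = f` for uncountably many `i`, then
every neighbourhood of `f` contains a product `a i * b j` with `i ≠ j`. -/
theorem exists_ne_mul_mem_of_uncountable {ι S : Type*} [Uncountable ι] [Semigroup S]
    [TopologicalSpace S] [ContinuousMul S] [SecondCountableTopology S] {a b : ι → S} {f : S}
    (hab : ∀ i, a i * b i = f) {U : Set S} (hU : U ∈ 𝓝 f) :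
    ∃ i j, i ≠ j ∧ a i * b j ∈ U := by
  have hnhds : ∀ i, ∃ V ∈ 𝓝 (a i), ∃ W ∈ 𝓝 (b i), ∀ v ∈ V, ∀ w ∈ W, v * w ∈ U := fun i => by
    have := (continuous_mul (M := S)).continuousAt (x := (a i, b i))
    have h := this.preimage_mem_nhds (t := U) (by simpa [hab i] using hU)
    rw [nhds_prod_eq, mem_prod_iff] at h
    obtain ⟨V, hV, W, hW, h⟩ := h
    exact ⟨V, hV, W, hW, fun v hv w hw => h (mk_mem_prod hv hw)⟩
  choose V hV W hW hVW using hnhds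
  -- Only the second factor has to move: `a i` already lies in `V i`, so `b j ∈ W i` suffices.
  obtain ⟨i, j, hij, -, hj⟩ := exists_ne_mem_of_uncountable (fun i => (a i, b i))
    (fun i => univ ×ˢ W i) (fun i => prod_mem_nhds univ_mem (hW i))
  exact ⟨i, j, hij, hVW i _ (mem_of_mem_nhds (hV i)) _ hj⟩

/-! ### Splitting a sequence along the binary tree -/

/-- Given `f` and functions `g n` agreeing with `f` below `n`, there are factorisations
`f = b x ∘ a x`, indexed by the branches `x` of the binary tree, such that the mixed compositions
`b y ∘ a x` are among the `g n`. -/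
theorem exists_branch_factorization {A : Type*} (f : ℕ → A) (g : ℕ → ℕ → A)
    (hg : ∀ n, ∀ k < n, g n k = f k) :
    ∃ (a : (ℕ → Bool) → ℕ → ℕ) (b : (ℕ → Bool) → ℕ → A),
      (∀ x, b x ∘ a x = f) ∧ ∀ x y, x ≠ y → ∃ n, b y ∘ a x = g n := by
  classical
  obtain ⟨c⟩ : Nonempty (ℕ ≃ List Bool) :=
    nonempty_equiv_of_countable
  -- `a x k` codes the prefix of `x` of length `k`. Reading a coded string, `b y` follows `f` if the
  -- string is a prefix of `y`, and otherwise the `g` selected by the first disagreement with `y`.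
  let a : (ℕ → Bool) → ℕ → ℕ := fun x k => c.symm (List.ofFn fun i : Fin k => x i)
  let d : (ℕ → Bool) → List Bool → ℕ → Prop := fun y s n => ∃ h : n < s.length, s[n] ≠ y n
  let b : (ℕ → Bool) → ℕ → A := fun y m =>
    if h : ∃ n, d y (c m) n then g (Nat.find h + 1) (c m).length else f (c m).length
  have hd : ∀ x y k n, d y (c (a x k)) n ↔ n < k ∧ x n ≠ y n := by
    intro x y k n
    simp [d, a]
  have hl : ∀ x k, (c (a x k)).length = k := by
    intro x k
    simp [a]
  refine ⟨a, b, fun x => ?_, fun x y hxy => ?_⟩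
  · funext k
    have : ¬ ∃ n, d x (c (a x k)) n := by simp [hd]
    simp only [comp_apply, b, dif_neg this, hl]
  · have hne : ∃ n, x n ≠ y n := Function.ne_iff.1 hxy
    -- Let `N` be the first place where `x` and `y` differ. Prefixes of `x` longer than `N` first
    -- leave `y` at `N`; those of length `k ≤ N` give `f k`, which is `g (N + 1) k` because `k < N +
    -- 1`.
    refine ⟨Nat.find hne + 1, ?_⟩
    funext k
    simp only [comp_apply, b]
    split_ifs with h
    · have : Nat.find h = Nat.find hne := by
        obtain ⟨h1, h2⟩ := (hd _ _ _ _).1 (Nat.find_spec h)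
        refine le_antisymm (Nat.find_min' _ ?_) (Nat.find_min' _ h2)
        exact (hd _ _ _ _).2 ⟨(Nat.find_min' hne h2).trans_lt h1, Nat.find_spec hne⟩
      rw [this, hl]
    · rw [hl, hg]
      by_contra hk
      exact h ⟨Nat.find hne, (hd _ _ _ _).2 ⟨by omega, Nat.find_spec hne⟩⟩

/-! ### Semigroups of sequences -/

/-- The topology on `S` transported from the product topology on `ℕ → A`, for `A` discrete. -/
abbrev sequenceTopology {S A : Type*} (e : S ≃ (ℕ → A)) : TopologicalSpace S :=
  TopologicalSpace.induced e (@Pi.topologicalSpace ℕ (fun _ => A) fun _ => ⊥)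

section Sequence

variable {S : Type u} {A : Type*} {e : S ≃ (ℕ → A)}

theorem le_sequenceTopology_iff {t : TopologicalSpace S} :
    t ≤ sequenceTopology e ↔ ∀ x y, IsOpen[t] {s | e s x = y} := by
  let : TopologicalSpace A := ⊥
  have : DiscreteTopology A := ⟨rfl⟩
  rw [sequenceTopology, ← continuous_iff_le_induced, continuous_pi_iff]
  exact forall_congr' fun x => continuous_discrete_rng

theorem isOpen_sequenceTopology (e : S ≃ (ℕ → A)) (x : ℕ) (y : A) :
    IsOpen[sequenceTopology e] {s | e s x = y} :=
  le_sequenceTopology_iff.1 le_rfl x y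

theorem mem_nhds_sequenceTopology (e : S ≃ (ℕ → A)) (s : S) (n : ℕ) :
    {s' | ∀ k < n, e s' k = e s k} ∈ @nhds S (sequenceTopology e) s := by
  let := sequenceTopology e
  have : {s' | ∀ k < n, e s' k = e s k} = ⋂ k ∈ Finset.range n, {s' | e s' k = e s k} := by
    ext; simp
  rw [this, Filter.biInter_finset_mem]
  exact fun k _ => (isOpen_sequenceTopology e k _).mem_nhds rfl

theorem polishSpace_sequenceTopology [Countable A] (e : S ≃ (ℕ → A)) :
    @PolishSpace S (sequenceTopology e) := by
  let : TopologicalSpace A := ⊥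
  have : DiscreteTopology A := ⟨rfl⟩
  have : PolishSpace A := inferInstance
  exact e.polishSpace_induced

theorem secondCountableTopology_sequenceTopology [Countable A] (e : S ≃ (ℕ → A)) :
    @SecondCountableTopology S (sequenceTopology e) :=
  let := sequenceTopology e
  have := polishSpace_sequenceTopology e
  inferInstance

theorem t2Space_sequenceTopology [Countable A] (e : S ≃ (ℕ → A)) :
    @T2Space S (sequenceTopology e) :=
  let := sequenceTopology e
  have := polishSpace_sequenceTopology e
  inferInstance

variable [Semigroup S]

/-- If each value of `s * u` depends only on one value of `s` and, given it, on one value of `u`,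
then multiplication is continuous. -/
theorem isCompatible_sequenceTopology
    (hmul : ∀ a : A, ∃ k, ∀ x s s' u u', e s x = a → e s' x = a → e u k = e u' k →
      e (s * u) x = e (s' * u') x) :
    IsCompatible S (sequenceTopology e) := by
  let : TopologicalSpace A := ⊥
  have : DiscreteTopology A := ⟨rfl⟩
  let := sequenceTopology e
  refine ⟨continuous_induced_rng.2 (continuous_pi fun x => ?_)⟩
  refine continuous_iff_continuousAt.2 fun p => ?_
  obtain ⟨k, hk⟩ := hmul (e p.1 x)
  rw [ContinuousAt, nhds_discrete A, tendsto_pure]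
  have h1 : {s | e s x = e p.1 x} ∈ 𝓝 p.1 := (isOpen_sequenceTopology e _ _).mem_nhds rfl
  have h2 : {u | e u k = e p.2 k} ∈ 𝓝 p.2 := (isOpen_sequenceTopology e _ _).mem_nhds rfl
  rw [nhds_prod_eq]
  filter_upwards [prod_mem_prod h1 h2] with q hq
  exact hk x _ _ _ _ hq.1 rfl hq.2

/-- If every self-map of `ℕ` is realised by left multiplication, then every second countable
topology compatible with `S` is contained in the topology of pointwise convergence. -/
theorem sequenceTopology_le_of_secondCountable
    (hcomp : ∃ ι : (ℕ → ℕ) → S, ∀ a s, e (ι a * s) = e s ∘ a) {t : TopologicalSpace S}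
    (ht : IsCompatible S t) (h2 : @SecondCountableTopology S t) : sequenceTopology e ≤ t := by
  obtain ⟨ι, hι⟩ := hcomp
  refine le_of_nhds_le_nhds fun f U hU => ?_
  by_contra hcon
  have : ∀ n, ∃ g, (∀ k < n, e g k = e f k) ∧ g ∉ U := fun n => by
    by_contra! h
    exact hcon (mem_of_superset (mem_nhds_sequenceTopology e f n) h)
  choose g hgf hgU using this
  obtain ⟨a, b, hab, hne⟩ := exists_branch_factorization (e f) (fun n => e (g n)) hgf
  have : ContinuousMul S := ht
  have : Uncountable (ℕ → Bool) := by
    rw [← Cardinal.aleph0_lt_mk_iff]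
    simpa using Cardinal.cantor Cardinal.aleph0
  obtain ⟨x, y, hxy, hU'⟩ := exists_ne_mul_mem_of_uncountable (f := f) (a := fun x => ι (a x))
    (b := fun x => e.symm (b x)) (fun x => e.injective (by simp [hι, hab])) hU
  obtain ⟨n, hn⟩ := hne x y hxy
  have : ι (a x) * e.symm (b y) = g n := e.injective (by simp [hι, hn])
  exact hgU n (this ▸ hU')

/-- If the sets `{s | e s x = y}` are complements of solution sets of equations `p * s * q = r`,
then the topology of pointwise convergence is contained in each semicompatible `T₁` topology. -/
theorem le_sequenceTopology_of_isSemicompatible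
    (hsep : ∀ x y, ∃ p q r : S, ∀ s, e s x = y ↔ p * s * q ≠ r) {t : TopologicalSpace S}
    (h1 : @T1Space S t) (ht : IsSemicompatible S t) : t ≤ sequenceTopology e := by
  rw [le_sequenceTopology_iff]
  intro x y
  obtain ⟨p, q, r, h⟩ := hsep x y
  have : SeparatelyContinuousMul S := ht
  have hc : Continuous fun s : S => p * s * q :=
    (continuous_mul_const q).comp (continuous_const_mul p)
  have heq : {s | e s x = y} = (fun s => p * s * q) ⁻¹' {r}ᶜ := by
    ext s
    simp [h]
  exact heq ▸ isOpen_compl_singleton.preimage hc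

end Sequence

/-! ### The canonical topologies of a semigroup -/

section Canonical

variable {S : Type u} [Semigroup S]

theorem IsCompatible.isSemicompatible {t : TopologicalSpace S} (ht : IsCompatible S t) :
    IsSemicompatible S t :=
  have : ContinuousMul S := ht
  (inferInstance : SeparatelyContinuousMul S)

theorem frechetMarkovTopology_le_minimumFrechetTopology :
    frechetMarkovTopology S ≤ minimumFrechetTopology S :=
  sSup_le_sSup fun _ ht => ⟨ht.1, ht.2.isSemicompatible⟩

theorem hausdorffMarkovTopology_le_frechetMarkovTopology :
    hausdorffMarkovTopology S ≤ frechetMarkovTopology S :=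
  sSup_le_sSup fun t ht => ⟨@T2Space.t1Space S t ht.1, ht.2⟩

/-- Joint continuity is what the product step uses, since the variable may occur in both factors. -/
theorem continuous_freeMagma_lift_cons [TopologicalSpace S] [ContinuousMul S] {n : ℕ}
    (p : Fin n → S) (a : FreeMagma (Fin (n + 1))) :
    Continuous fun s => FreeMagma.lift (Fin.cons s p : Fin (n + 1) → S) a := by
  induction a with
  | ih1 i =>
    refine Fin.cases ?_ (fun i => ?_) i
    · simpa using! continuous_id
    · simpa using continuous_const
  | ih2 a b ha hb => simpa using! ha.mul hb

theorem hausdorffMarkovTopology_le_semigroupZariskiTopology :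
    hausdorffMarkovTopology S ≤ semigroupZariskiTopology S := by
  refine sSup_le fun t ht => le_generateFrom ?_
  rintro _ ⟨E, ⟨n, m, p, q, a, b, rfl⟩, rfl⟩
  have : T2Space S := ht.1
  have : ContinuousMul S := ht.2
  exact (isClosed_eq (continuous_freeMagma_lift_cons p a)
    (continuous_freeMagma_lift_cons q b)).isOpen_compl

theorem isElementaryAlgebraic_mul_mul_eq (p q r : S) :
    IsElementaryAlgebraic {s : S | p * s * q = r} :=
  -- Variable `0` is the unknown and parameters start at `1`; the right-hand term ignores the
  -- unknown.
  ⟨2, 1, ![p, q], ![r], .of 1 * .of 0 * .of 2, .of 1, by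
    ext s
    simp only [mem_ofPred_eq, map_mul, FreeMagma.lift_of]
    rfl⟩

variable {A : Type*} {e : S ≃ (ℕ → A)}

theorem semigroupZariskiTopology_le_sequenceTopology
    (hsep : ∀ x y, ∃ p q r : S, ∀ s, e s x = y ↔ p * s * q ≠ r) :
    semigroupZariskiTopology S ≤ sequenceTopology e := by
  rw [le_sequenceTopology_iff]
  intro x y
  obtain ⟨p, q, r, h⟩ := hsep x y
  refine TopologicalSpace.isOpen_generateFrom_of_mem
    ⟨_, isElementaryAlgebraic_mul_mul_eq p q r, ?_⟩
  ext s
  simp [h]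

/-- A semigroup of sequences with continuous multiplication, enough left multiplications and
enough separating equations has the topology of pointwise convergence as its unique second
countable compatible `T₁` topology, and this is also each of its canonical topologies. -/
theorem sequenceTopology_characterization [Countable A]
    (hmul : IsCompatible S (sequenceTopology e))
    (hcomp : ∃ ι : (ℕ → ℕ) → S, ∀ a s, e (ι a * s) = e s ∘ a)
    (hsep : ∀ x y, ∃ p q r : S, ∀ s, e s x = y ↔ p * s * q ≠ r) :
    (∀ t : TopologicalSpace S,
        (@SecondCountableTopology _ t ∧ @T1Space _ t ∧ IsCompatible S t) ↔
          t = sequenceTopology e) ∧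
      (∀ (T : Type*) [Semigroup T] [τ : TopologicalSpace T] [ContinuousMul T]
        [SecondCountableTopology T] (φ : S →ₙ* T), Continuous[sequenceTopology e, τ] φ) ∧
      sequenceTopology e = semigroupZariskiTopology S ∧
      sequenceTopology e = minimumFrechetTopology S ∧
      sequenceTopology e = frechetMarkovTopology S ∧
      sequenceTopology e = hausdorffMarkovTopology S ∧
      sequenceTopology e = secondCountableContinuityTopology S ∧
      @PolishSpace S (sequenceTopology e) := by
  have h2 := secondCountableTopology_sequenceTopology e
  have hT2 := t2Space_sequenceTopology e
  -- The Markov and minimum Fréchet topologies are squeezed in a cycle of inequalities that starts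
  -- and ends at the pointwise topology.
  have hHM : sequenceTopology e ≤ hausdorffMarkovTopology S := le_sSup ⟨hT2, hmul⟩
  have hMF : minimumFrechetTopology S ≤ sequenceTopology e :=
    sSup_le fun t ht => le_sequenceTopology_of_isSemicompatible hsep ht.1 ht.2
  have hFM := hausdorffMarkovTopology_le_frechetMarkovTopology (S := S)
  have hFM' := frechetMarkovTopology_le_minimumFrechetTopology (S := S)
  refine ⟨fun t => ⟨fun ⟨h, h1, ht⟩ => le_antisymm
      (le_sequenceTopology_of_isSemicompatible hsep h1 ht.isSemicompatible)
      (sequenceTopology_le_of_secondCountable hcomp ht h), ?_⟩,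
    fun T _ τ _ _ φ => ?_,
    le_antisymm (hHM.trans hausdorffMarkovTopology_le_semigroupZariskiTopology)
      (semigroupZariskiTopology_le_sequenceTopology hsep),
    le_antisymm (hHM.trans (hFM.trans hFM')) hMF,
    le_antisymm (hHM.trans hFM) (hFM'.trans hMF),
    le_antisymm hHM (hFM.trans (hFM'.trans hMF)),
    le_antisymm (le_generateFrom ?_) ?_, polishSpace_sequenceTopology e⟩
  · rintro rfl
    exact ⟨h2, @T2Space.t1Space S (sequenceTopology e) hT2, hmul⟩
  · rw [continuous_iff_le_induced]
    -- The topology pulled back along `φ` is second countable and compatible; it need not be `T₁`,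
    -- and the bound does not ask for that.
    refine sequenceTopology_le_of_secondCountable hcomp ?_
      (TopologicalSpace.secondCountableTopology_induced S T φ)
    exact @continuousMul_induced _ _ _ _ _ _ _ τ _ φ
  · rintro U ⟨t, ht2, ht, hU⟩
    exact sequenceTopology_le_of_secondCountable hcomp ht ht2 U hU
  · exact fun U hU => TopologicalSpace.isOpen_generateFrom_of_mem ⟨_, h2, hmul, hU⟩

end Canonical

/-! ### The full transformation monoid -/

namespace FullTransformation

/-- Full transformations of `ℕ` as sequences. -/
def equivSequence : FullTransformation ℕ ≃ (ℕ → ℕ) := Equiv.refl _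

theorem pointwiseTopology_eq : pointwiseTopology ℕ = sequenceTopology equivSequence :=
  (@induced_id _ (pointwiseTopology ℕ)).symm

theorem equivSequence_mul (f g : FullTransformation ℕ) (x : ℕ) :
    equivSequence (f * g) x = equivSequence g (equivSequence f x) := rfl

theorem isCompatible : IsCompatible (FullTransformation ℕ) (sequenceTopology equivSequence) :=
  isCompatible_sequenceTopology fun a => ⟨a, fun x s s' u u' h h' hu => by
    rw [equivSequence_mul, equivSequence_mul, h, h', hu]⟩

/-- With `p` constantly `x`, the product is constant with value `q (s x)`. As `q` sends `y` to `0`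
and all else to `1`, it is constantly `1` exactly when `s x ≠ y`. -/
theorem exists_separating_equation (x y : ℕ) : ∃ p q r : FullTransformation ℕ,
    ∀ s, equivSequence s x = y ↔ p * s * q ≠ r := by
  refine ⟨equivSequence.symm fun _ => x, equivSequence.symm fun z => if z = y then 0 else 1,
    equivSequence.symm fun _ => 1, fun s => ?_⟩
  rw [← equivSequence.injective.ne_iff, Function.ne_iff]
  simp [equivSequence_mul]

end FullTransformation

/-! ### The partial function monoid -/

namespace PartialTransformation

/-- Partial transformations of `ℕ` as sequences of partial values. -/
def equivSequence : PartialTransformation ℕ ≃ (ℕ → Part ℕ) := Equiv.refl _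

theorem equivSequence_mul (f g : PartialTransformation ℕ) (x : ℕ) :
    equivSequence (f * g) x = (equivSequence f x).bind (equivSequence g) := rfl

theorem isOpen_setOf_mem (x y : ℕ) :
    IsOpen[partialPointwiseTopology ℕ] {f : PartialTransformation ℕ | y ∈ f x} :=
  TopologicalSpace.isOpen_generateFrom_of_mem (Or.inl ⟨x, y, rfl⟩)

theorem isOpen_setOf_not_dom (x : ℕ) :
    IsOpen[partialPointwiseTopology ℕ] {f : PartialTransformation ℕ | ¬ (f x).Dom} :=
  TopologicalSpace.isOpen_generateFrom_of_mem (Or.inr ⟨x, rfl⟩)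

theorem partialPointwiseTopology_eq :
    partialPointwiseTopology ℕ = sequenceTopology equivSequence := by
  have hsome : ∀ x y, {f : PartialTransformation ℕ | equivSequence f x = Part.some y} =
      {f | y ∈ f x} := fun x y => by
    ext f
    exact Part.eq_some_iff
  have hnone : ∀ x, {f : PartialTransformation ℕ | equivSequence f x = Part.none} =
      {f | ¬ (f x).Dom} := fun x => by
    ext f
    exact Part.eq_none_iff'
  refine le_antisymm (le_sequenceTopology_iff.2 fun x y => ?_) (le_generateFrom ?_)
  · induction y using Part.induction_on with
    | hnone => exact hnone x ▸ isOpen_setOf_not_dom x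
    | hsome y => exact hsome x y ▸ isOpen_setOf_mem x y
  · rintro _ (⟨x, y, rfl⟩ | ⟨x, rfl⟩)
    · exact hsome x y ▸ isOpen_sequenceTopology _ _ _
    · exact hnone x ▸ isOpen_sequenceTopology _ _ _

theorem isCompatible : IsCompatible (PartialTransformation ℕ) (sequenceTopology equivSequence) :=
  isCompatible_sequenceTopology fun a => by
    induction a using Part.induction_on with
    | hnone =>
      -- If `s` is undefined at `x`, so is the product, whatever `u` is; the `0` is arbitrary.
      refine ⟨0, fun x s s' u u' h h' _ => ?_⟩
      rw [equivSequence_mul, equivSequence_mul, h, h', Part.bind_none, Part.bind_none]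
    | hsome a =>
      refine ⟨a, fun x s s' u u' h h' hu => ?_⟩
      rw [equivSequence_mul, equivSequence_mul, h, h', Part.bind_some, Part.bind_some, hu]

theorem exists_separating_equation (x : ℕ) (y : Part ℕ) : ∃ p q r : PartialTransformation ℕ,
    ∀ s, equivSequence s x = y ↔ p * s * q ≠ r := by
  classical
  induction y using Part.induction_on with
  | hnone =>
    -- Here `q` collapses all defined values to `0`, so equality with `r` detects that `s x` is
    -- defined.
    refine ⟨equivSequence.symm fun _ => Part.some x, equivSequence.symm fun _ => Part.some 0,
      equivSequence.symm fun _ => Part.some 0, fun s => ?_⟩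
    rw [← equivSequence.injective.ne_iff, Function.ne_iff]
    simp only [equivSequence_mul, Equiv.apply_symm_apply, Part.bind_some, exists_const]
    induction equivSequence s x using Part.induction_on with
    | hnone => simp
    | hsome z => simp
  | hsome y =>
    -- Here `q` is defined only at `y`, so the product is the empty function `r` unless `s x` is
    -- `y`.
    refine ⟨equivSequence.symm fun _ => Part.some x,
      equivSequence.symm fun z => if z = y then Part.some 0 else Part.none,
      equivSequence.symm fun _ => Part.none, fun s => ?_⟩
    rw [← equivSequence.injective.ne_iff, Function.ne_iff]
    simp only [equivSequence_mul, Equiv.apply_symm_apply, Part.bind_some, exists_const]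
    induction equivSequence s x using Part.induction_on with
    | hnone => simp [eq_comm]
    | hsome z => by_cases h : z = y <;> simp [h]

end PartialTransformation

theorem theorem9p10 :
    -- the full transformation monoid
    ((∀ t : TopologicalSpace (FullTransformation ℕ),
        (@SecondCountableTopology _ t ∧ @T1Space _ t ∧ IsCompatible (FullTransformation ℕ) t) ↔
          t = pointwiseTopology ℕ) ∧
      (∀ (T : Type u) [Semigroup T] [τ : TopologicalSpace T] [ContinuousMul T]
        [SecondCountableTopology T] (φ : FullTransformation ℕ →ₙ* T),
        Continuous[pointwiseTopology ℕ, τ] φ) ∧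
      pointwiseTopology ℕ = semigroupZariskiTopology (FullTransformation ℕ) ∧
      pointwiseTopology ℕ = minimumFrechetTopology (FullTransformation ℕ) ∧
      pointwiseTopology ℕ = frechetMarkovTopology (FullTransformation ℕ) ∧
      pointwiseTopology ℕ = hausdorffMarkovTopology (FullTransformation ℕ) ∧
      pointwiseTopology ℕ = secondCountableContinuityTopology (FullTransformation ℕ) ∧
      @PolishSpace (FullTransformation ℕ) (pointwiseTopology ℕ)) ∧
    -- the partial function monoid
    ((∀ t : TopologicalSpace (PartialTransformation ℕ),
        (@SecondCountableTopology _ t ∧ @T1Space _ t ∧ IsCompatible (PartialTransformation ℕ) t) ↔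
          t = partialPointwiseTopology ℕ) ∧
      (∀ (T : Type u) [Semigroup T] [τ : TopologicalSpace T] [ContinuousMul T]
        [SecondCountableTopology T] (φ : PartialTransformation ℕ →ₙ* T),
        Continuous[partialPointwiseTopology ℕ, τ] φ) ∧
      partialPointwiseTopology ℕ = semigroupZariskiTopology (PartialTransformation ℕ) ∧
      partialPointwiseTopology ℕ = minimumFrechetTopology (PartialTransformation ℕ) ∧
      partialPointwiseTopology ℕ = frechetMarkovTopology (PartialTransformation ℕ) ∧
      partialPointwiseTopology ℕ = hausdorffMarkovTopology (PartialTransformation ℕ) ∧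
      partialPointwiseTopology ℕ =
        secondCountableContinuityTopology (PartialTransformation ℕ) ∧
      @PolishSpace (PartialTransformation ℕ) (partialPointwiseTopology ℕ)) := by
  rw [FullTransformation.pointwiseTopology_eq, PartialTransformation.partialPointwiseTopology_eq]
  have : Countable (Part ℕ) := by
    classical exact (Part.equivOption (α := ℕ)).injective.countable
  exact ⟨sequenceTopology_characterization FullTransformation.isCompatible
      ⟨fun a => a, fun _ _ => rfl⟩ FullTransformation.exists_separating_equation,
    sequenceTopology_characterization PartialTransformation.isCompatible
      ⟨fun a => PartialTransformation.equivSequence.symm fun x => Part.some (a x), fun a s => by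
        funext x
        simp [PartialTransformation.equivSequence_mul]⟩
      PartialTransformation.exists_separating_equation⟩
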